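/- **Setting.** Fix a first-order language of scalars containing at least binary symbols $+,\times$ and constants $0,1$. For a set $S$ of rewrite rules on scalar terms, $S$ is a *scalar rewrite system* if it is terminating and ground confluent, the closed terms $0$ and $1$ are $S$-normal, and for all closed scalar terms $\lambda,\mu,\nu$ the two terms of each of the following pairs have the same $S$-normal form: $0+\lambda$ and $\lambda$; $0\times\lambda$ and $0$; $1\times\lambda$ and $\lambda$; $\lambda\times(\mu+\nu)$ and $(\lambda\times\mu)+(\lambda\times\nu)$; $(\lambda+\mu)+\nu$ and $\lambda+(\mu+\nu)$; $\lambda+\mu$ and $\mu+\lambda$; $(\lambda\times\mu)\times\nu$ and $\lambda\times(\mu\times\nu)$; $\lambda\times\mu$ and $\mu\times\lambda$. Let $S$ be a scalar rewrite system and let $K$ be a field defined by $S$: the scalar symbols are interpreted in $K$, with $+,\times,0,1$ interpreted by the field operations, and two closed scalar terms have the same value in $K$ if and only if they have the same $S$-normal form. Consider the four-sorted language with the sort $K$ of scalar terms, sorts $E,F,G$ of vectors, for each of $E,F,G$ a copy of the symbols $+$, $.$ (product of a scalar and a vector) and $\mathbf 0$, and a symbol $\otimes$ of rank $\langle E,F,G\rangle$.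 The system $R'$ consists, for each of the sorts $E,F,G$, of the rules $$\mathbf u+\mathbf 0\to\mathbf u,\quad 0.\mathbf u\to\mathbf 0,\quad 1.\mathbf u\to\mathbf u,\quad \lambda.\mathbf 0\to\mathbf 0,\quad \lambda.(\mu.\mathbf u)\to(\lambda\times\mu).\mathbf u,$$ $$\lambda.\mathbf u+\mu.\mathbf u\to(\lambda+\mu).\mathbf u,\quad \lambda.\mathbf u+\mathbf u\to(\lambda+1).\mathbf u,\quad \mathbf u+\mathbf u\to(1+1).\mathbf u,\quad \lambda.(\mathbf u+\mathbf v)\to\lambda.\mathbf u+\lambda.\mathbf v,$$ together with the rules $$(\mathbf u+\mathbf v)\otimes\mathbf w\to(\mathbf u\otimes\mathbf w)+(\mathbf v\otimes\mathbf w),\quad (\lambda.\mathbf u)\otimes\mathbf v\to\lambda.(\mathbf u\otimes\mathbf v),\quad \mathbf u\otimes(\mathbf v+\mathbf w)\to(\mathbf u\otimes\mathbf v)+(\mathbf u\otimes\mathbf w),$$ $$\mathbf u\otimes(\lambda.\mathbf v)\to\lambda.(\mathbf u\otimes\mathbf v),\quad \mathbf 0\otimes\mathbf u\to\mathbf 0,\quad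 \mathbf u\otimes\mathbf 0\to\mathbf 0.$$ "Modulo AC" means modulo associativity and commutativity of the three vector additions. A term $t$ rewrites in one step to $u$ if there is a $t'=_{AC}t$ such that applying a rule of $R'\cup S$ at one occurrence in $t'$ gives a term $=_{AC}u$. Normal forms are taken for this relation. **Proposition.** Let $n,p\ge 0$ and let $\mathbf t,\mathbf u$ be terms of sort $G$ whose variables of sort $E$ are among $\mathbf x_1,\dots,\mathbf x_n$, whose variables of sort $F$ are among $\mathbf y_1,\dots,\mathbf y_p$, and that have no variables of sorts $G$ and $K$. The following are equivalent: 1. $\mathbf t$ and $\mathbf u$ have normal forms, and any normal form of $\mathbf t$ is identical modulo AC to any normal form of $\mathbf u$; 2. the equation $\mathbf t=\mathbf u$ is valid (true for all assignments of the variables) in all structures formed by three $K$-vector spaces $E,F,G$ and a bilinear operation $\otimes:E\times F\to G$; 3. the equation $\mathbf t=\mathbf u$ is valid in all structures formed by two $K$-vector spaces $E,F$ and their tensorial product, i.e. a vector space $G$ with a bilinear operation $\otimes:E\times F\to G$ such that for all bases $(e_i)_{i\in I}$ of $E$ and $(e'_j)_{j\in J}$ of $F$ the family $(e_i\otimes e'_j)_{(i,j)\in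 I\times J}$ is a basis of $G$; 4. $\mathbf t$ and $\mathbf u$ have the same denotation in $K^{np}$ for the assignment $\mathbf x_i\mapsto e_i$, $\mathbf y_j\mapsto e'_j$, where $(e_i)$, $(e'_j)$, $(e''_k)$ are the canonical bases of $K^n$, $K^p$, $K^{np}$ and $\otimes$ is the unique bilinear operation $K^n\times K^p\to K^{np}$ with $e_i\otimes e'_j=e''_{p(i-1)+j}$. -/

import Mathlib

universe u v w a b

namespace BilinearRewriting

/-! ### Generic notions for a reduction relation -/

/-- `c` is irreducible for the relation `r`. -/
def IsNormal {T : Type*} (r : T → T → Prop) (c : T) : Prop := ∀ d, ¬ r c d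

/-- `c` is a normal form of `t` for the relation `r`. -/
def IsNormalForm {T : Type*} (r : T → T → Prop) (t c : T) : Prop :=
  Relation.ReflTransGen r t c ∧ IsNormal r c

/-! ### Scalars -/

/-- The distinguished symbols `+`, `×`, `0`, `1` of a language of scalars. The language may have
further function symbols; its terms of type `L.Term Empty` are the closed scalar terms. -/
structure ScalarSymbols (L : FirstOrder.Language.{a, b}) where
  add : L.Functions 2
  mul : L.Functions 2
  zero : L.Constants
  one : L.Constants

/-- One step of the (syntactic) rewriting relation of the set of rules `S`: some subterm that is
an instance `σ l` of a rule `l ⟶ r` of `S` is replaced by `σ r`. -/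
inductive ScalarStep {L : FirstOrder.Language.{a, b}} (S : Set (L.Term ℕ × L.Term ℕ)) {α : Type} :
    L.Term α → L.Term α → Prop
  | rule {l r : L.Term ℕ} (h : (l, r) ∈ S) (σ : ℕ → L.Term α) :
      ScalarStep S (l.subst σ) (r.subst σ)
  | congr {k : ℕ} (f : L.Functions k) (ts : Fin k → L.Term α) (i : Fin k) (t' : L.Term α)
      (h : ScalarStep S (ts i) t') :
      ScalarStep S (FirstOrder.Language.Term.func f ts) (FirstOrder.Language.Term.func f (Function.update ts i t'))

/-- Two closed scalar terms have the same `S`-normal form. -/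
def SameScalarNF {L : FirstOrder.Language.{a, b}} (S : Set (L.Term ℕ × L.Term ℕ))
    (x y : L.Term Empty) : Prop :=
  ∃ c, IsNormalForm (ScalarStep S) x c ∧ IsNormalForm (ScalarStep S) y c

/-- Scalar rewrite systems. -/
structure IsScalarRewriteSystem {L : FirstOrder.Language.{a, b}} (sym : ScalarSymbols L)
    (S : Set (L.Term ℕ × L.Term ℕ)) : Prop where
  terminating : WellFounded fun x y : L.Term ℕ => ScalarStep S y x
  ground_confluent : ∀ x y z : L.Term Empty, Relation.ReflTransGen (ScalarStep S) x y →
    Relation.ReflTransGen (ScalarStep S) x z →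
    ∃ w, Relation.ReflTransGen (ScalarStep S) y w ∧ Relation.ReflTransGen (ScalarStep S) z w
  zero_add : ∀ x, SameScalarNF S (sym.add.apply₂ sym.zero.term x) x
  zero_mul : ∀ x, SameScalarNF S (sym.mul.apply₂ sym.zero.term x) sym.zero.term
  one_mul : ∀ x, SameScalarNF S (sym.mul.apply₂ sym.one.term x) x
  mul_add : ∀ x y z, SameScalarNF S (sym.mul.apply₂ x (sym.add.apply₂ y z))
    (sym.add.apply₂ (sym.mul.apply₂ x y) (sym.mul.apply₂ x z))
  add_assoc : ∀ x y z, SameScalarNF S (sym.add.apply₂ (sym.add.apply₂ x y) z)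
    (sym.add.apply₂ x (sym.add.apply₂ y z))
  add_comm : ∀ x y, SameScalarNF S (sym.add.apply₂ x y) (sym.add.apply₂ y x)
  mul_assoc : ∀ x y z, SameScalarNF S (sym.mul.apply₂ (sym.mul.apply₂ x y) z)
    (sym.mul.apply₂ x (sym.mul.apply₂ y z))
  mul_comm : ∀ x y, SameScalarNF S (sym.mul.apply₂ x y) (sym.mul.apply₂ y x)
  zero_normal : IsNormal (ScalarStep S) (sym.zero.term : L.Term Empty)
  one_normal : IsNormal (ScalarStep S) (sym.one.term : L.Term Empty)

/-- The value in `K` of a closed scalar term. -/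
def evalScalar {L : FirstOrder.Language.{a, b}} (K : Type u) [L.Structure K] (x : L.Term Empty) : K :=
  x.realize (Empty.elim : Empty → K)

/-- The field `K` is defined by the scalar rewrite system `S`: the symbols `+`, `×`, `0`, `1` are
interpreted by the operations of `K`, and two closed scalar terms have the same value in `K` exactly
when they have the same `S`-normal form. -/
structure Defines {L : FirstOrder.Language.{a, b}} (sym : ScalarSymbols L) (S : Set (L.Term ℕ × L.Term ℕ))
    (K : Type u) [Field K] [L.Structure K] : Prop where
  add : ∀ x y : K, FirstOrder.Language.Structure.funMap sym.add ![x, y] = x + y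
  mul : ∀ x y : K, FirstOrder.Language.Structure.funMap sym.mul ![x, y] = x * y
  zero : (sym.zero : K) = 0
  one : (sym.one : K) = 1
  eval_eq_iff : ∀ x y : L.Term Empty, evalScalar K x = evalScalar K y ↔ SameScalarNF S x y

/-! ### Terms

The terms of the four-sorted language without variables of sort `K` or `G`: `L.Term Empty` is the
sort `K`, `LinTerm L X` the sort `E` (variables in `X`), `LinTerm L Y` the sort `F` (variables
in `Y`), and `TensTerm L X Y` the sort `G`. -/

/-- Terms of sort `E` (or `F`) with variables in `X`. -/
inductive LinTerm (L : FirstOrder.Language.{a, b}) (X : Type) : Type (max a 0)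
  | var : X → LinTerm L X
  | zero : LinTerm L X
  | add : LinTerm L X → LinTerm L X → LinTerm L X
  | smul : L.Term Empty → LinTerm L X → LinTerm L X

/-- Terms of sort `G` with variables of sort `E` in `X`, of sort `F` in `Y`, and no variable of
sort `G`. -/
inductive TensTerm (L : FirstOrder.Language.{a, b}) (X Y : Type) : Type (max a 0)
  | zero : TensTerm L X Y
  | add : TensTerm L X Y → TensTerm L X Y → TensTerm L X Y
  | smul : L.Term Empty → TensTerm L X Y → TensTerm L X Y
  | tensor : LinTerm L X → LinTerm L Y → TensTerm L X Y

/-! ### Equality modulo associativity and commutativity of the three vector additions -/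

inductive LinAC {L : FirstOrder.Language.{a, b}} {X : Type} : LinTerm L X → LinTerm L X → Prop
  | refl (s) : LinAC s s
  | symm {s t} : LinAC s t → LinAC t s
  | trans {r s t} : LinAC r s → LinAC s t → LinAC r t
  | assoc (r s t) : LinAC (.add (.add r s) t) (.add r (.add s t))
  | comm (s t) : LinAC (.add s t) (.add t s)
  | add {s s' t t'} : LinAC s s' → LinAC t t' → LinAC (.add s t) (.add s' t')
  | smul (x) {s s'} : LinAC s s' → LinAC (.smul x s) (.smul x s')

inductive TensAC {L : FirstOrder.Language.{a, b}} {X Y : Type} : TensTerm L X Y → TensTerm L X Y → Prop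
  | refl (s) : TensAC s s
  | symm {s t} : TensAC s t → TensAC t s
  | trans {r s t} : TensAC r s → TensAC s t → TensAC r t
  | assoc (r s t) : TensAC (.add (.add r s) t) (.add r (.add s t))
  | comm (s t) : TensAC (.add s t) (.add t s)
  | add {s s' t t'} : TensAC s s' → TensAC t t' → TensAC (.add s t) (.add s' t')
  | smul (x) {s s'} : TensAC s s' → TensAC (.smul x s) (.smul x s')
  | tensor {s s' t t'} : LinAC s s' → LinAC t t' → TensAC (.tensor s t) (.tensor s' t')

/-! ### The rewrite systems -/

/-- Instances of the rules of the system `R`, on a sort of vectors `T` with operations `zero`,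
`add`, `smul`. -/
inductive RuleR {L : FirstOrder.Language.{a, b}} (sym : ScalarSymbols L) {T : Type*} (zero : T)
    (add : T → T → T) (smul : L.Term Empty → T → T) : T → T → Prop
  | add_zero (s) : RuleR sym zero add smul (add s zero) s
  | zero_smul (s) : RuleR sym zero add smul (smul sym.zero.term s) zero
  | one_smul (s) : RuleR sym zero add smul (smul sym.one.term s) s
  | smul_zero (x) : RuleR sym zero add smul (smul x zero) zero
  | smul_smul (x y s) :
      RuleR sym zero add smul (smul x (smul y s)) (smul (sym.mul.apply₂ x y) s)
  | smul_add_smul (x y s) :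
      RuleR sym zero add smul (add (smul x s) (smul y s)) (smul (sym.add.apply₂ x y) s)
  | smul_add_self (x s) :
      RuleR sym zero add smul (add (smul x s) s) (smul (sym.add.apply₂ x sym.one.term) s)
  | add_self (s) :
      RuleR sym zero add smul (add s s) (smul (sym.add.apply₂ sym.one.term sym.one.term) s)
  | smul_add (x s t) :
      RuleR sym zero add smul (smul x (add s t)) (add (smul x s) (smul x t))

/-- Instances of the six additional rules of the system `R'`. -/
inductive RuleTensor {L : FirstOrder.Language.{a, b}} {X Y : Type} :
    TensTerm L X Y → TensTerm L X Y → Prop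
  | add_tensor (r s t) :
      RuleTensor (.tensor (.add r s) t) (.add (.tensor r t) (.tensor s t))
  | smul_tensor (x s t) : RuleTensor (.tensor (.smul x s) t) (.smul x (.tensor s t))
  | tensor_add (r s t) :
      RuleTensor (.tensor r (.add s t)) (.add (.tensor r s) (.tensor r t))
  | tensor_smul (x s t) : RuleTensor (.tensor s (.smul x t)) (.smul x (.tensor s t))
  | zero_tensor (t) : RuleTensor (.tensor .zero t) .zero
  | tensor_zero (s) : RuleTensor (.tensor s .zero) .zero

/-- One application of a rule of `R' ∪ S` at some occurrence of a term of sort `E` (or `F`). -/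
inductive LinStep {L : FirstOrder.Language.{a, b}} (sym : ScalarSymbols L) (S : Set (L.Term ℕ × L.Term ℕ))
    {X : Type} : LinTerm L X → LinTerm L X → Prop
  | rule {s s'} (h : RuleR sym LinTerm.zero LinTerm.add LinTerm.smul s s') : LinStep sym S s s'
  | scalar {x x'} (s) (h : ScalarStep S x x') : LinStep sym S (.smul x s) (.smul x' s)
  | add_left {s s'} (t) (h : LinStep sym S s s') : LinStep sym S (.add s t) (.add s' t)
  | add_right (s) {t t'} (h : LinStep sym S t t') : LinStep sym S (.add s t) (.add s t')
  | smul (x) {s s'} (h : LinStep sym S s s') : LinStep sym S (.smul x s) (.smul x s')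

/-- One application of a rule of `R' ∪ S` at some occurrence of a term of sort `G`. -/
inductive TensStep {L : FirstOrder.Language.{a, b}} (sym : ScalarSymbols L) (S : Set (L.Term ℕ × L.Term ℕ))
    {X Y : Type} : TensTerm L X Y → TensTerm L X Y → Prop
  | rule {s s'} (h : RuleR sym TensTerm.zero TensTerm.add TensTerm.smul s s') :
      TensStep sym S s s'
  | tensor_rule {s s'} (h : RuleTensor s s') : TensStep sym S s s'
  | scalar {x x'} (s) (h : ScalarStep S x x') : TensStep sym S (.smul x s) (.smul x' s)
  | add_left {s s'} (t) (h : TensStep sym S s s') : TensStep sym S (.add s t) (.add s' t)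
  | add_right (s) {t t'} (h : TensStep sym S t t') : TensStep sym S (.add s t) (.add s t')
  | smul (x) {s s'} (h : TensStep sym S s s') : TensStep sym S (.smul x s) (.smul x s')
  | tensor_left {s s'} (t) (h : LinStep sym S s s') :
      TensStep sym S (.tensor s t) (.tensor s' t)
  | tensor_right (s) {t t'} (h : LinStep sym S t t') :
      TensStep sym S (.tensor s t) (.tensor s t')

/-- One step of `(R' ∪ S)/AC(+)`-rewriting on terms of sort `G`. -/
def TensStepAC {L : FirstOrder.Language.{a, b}} (sym : ScalarSymbols L) (S : Set (L.Term ℕ × L.Term ℕ))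
    {X Y : Type} (t t' : TensTerm L X Y) : Prop :=
  ∃ s s', TensAC t s ∧ TensStep sym S s s' ∧ TensAC s' t'

/-- The `(R' ∪ S)`-normal forms of `t` and `t'` exist and are identical modulo AC, whichever
normal forms (a priori) are chosen. -/
def NormalFormsAgree {L : FirstOrder.Language.{a, b}} (sym : ScalarSymbols L)
    (S : Set (L.Term ℕ × L.Term ℕ)) {X Y : Type} (t t' : TensTerm L X Y) : Prop :=
  (∃ c, IsNormalForm (TensStepAC sym S) t c) ∧ (∃ c', IsNormalForm (TensStepAC sym S) t' c') ∧
    ∀ c c', IsNormalForm (TensStepAC sym S) t c → IsNormalForm (TensStepAC sym S) t' c' →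
      TensAC c c'

/-! ### Denotations -/

section Denotation

variable {L : FirstOrder.Language.{a, b}} {X Y : Type} {K : Type u} [Field K] [L.Structure K]
  {E F G : Type v} [AddCommGroup E] [Module K E] [AddCommGroup F] [Module K F]
  [AddCommGroup G] [Module K G]

variable (K) in
/-- The denotation of a term of sort `E` (or `F`) for the assignment `φ`. -/
def LinTerm.eval (φ : X → E) : LinTerm L X → E
  | .var i => φ i
  | .zero => 0
  | .add s t => LinTerm.eval φ s + LinTerm.eval φ t
  | .smul x s => evalScalar K x • LinTerm.eval φ s

/-- The denotation of a term of sort `G` in the structure `(K, E, F, G, B)`, for the assignments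
`φ` and `ψ` of the variables of sorts `E` and `F`. -/
def TensTerm.eval (B : E →ₗ[K] F →ₗ[K] G) (φ : X → E) (ψ : Y → F) : TensTerm L X Y → G
  | .zero => 0
  | .add s t => TensTerm.eval B φ ψ s + TensTerm.eval B φ ψ t
  | .smul x s => evalScalar K x • TensTerm.eval B φ ψ s
  | .tensor s t => B (LinTerm.eval K φ s) (LinTerm.eval K ψ t)

/-- `G` with the bilinear operation `B` is a tensorial product of `E` and `F`: for all bases
`(e i)` of `E` and `(e' j)` of `F`, the family `(B (e i) (e' j))` is a basis of `G`. -/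
def IsTensorialProduct (B : E →ₗ[K] F →ₗ[K] G) : Prop :=
  ∀ (I J : Type v) (e : Module.Basis I K E) (e' : Module.Basis J K F),
    ∃ e'' : Module.Basis (I × J) K G, ∀ i j, e'' (i, j) = B (e i) (e' j)

end Denotation

/-- The equation `t = t'` is valid in all structures formed by three `K`-vector spaces and a
bilinear operation. -/
def ValidInBilinear {L : FirstOrder.Language.{a, b}} {X Y : Type} (K : Type u) [Field K] [L.Structure K]
    (t t' : TensTerm L X Y) : Prop :=
  ∀ (E F G : Type v) [AddCommGroup E] [Module K E] [AddCommGroup F] [Module K F]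
    [AddCommGroup G] [Module K G] (B : E →ₗ[K] F →ₗ[K] G) (φ : X → E) (ψ : Y → F),
    t.eval B φ ψ = t'.eval B φ ψ

/-- The equation `t = t'` is valid in all structures formed by two `K`-vector spaces and their
tensorial product. -/
def ValidInTensorial {L : FirstOrder.Language.{a, b}} {X Y : Type} (K : Type u) [Field K] [L.Structure K]
    (t t' : TensTerm L X Y) : Prop :=
  ∀ (E F G : Type v) [AddCommGroup E] [Module K E] [AddCommGroup F] [Module K F]
    [AddCommGroup G] [Module K G] (B : E →ₗ[K] F →ₗ[K] G), IsTensorialProduct B →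
    ∀ (φ : X → E) (ψ : Y → F), t.eval B φ ψ = t'.eval B φ ψ

/-- The bilinear operation `K ^ n × K ^ p → K ^ (n * p)` with `e i ⊗ e' j = e'' (p * i + j)`
(indices starting at `0`). -/
noncomputable def canonicalTensor (K : Type u) [Field K] (n p : ℕ) :
    (Fin n → K) →ₗ[K] (Fin p → K) →ₗ[K] (Fin (n * p) → K) :=
  (Pi.basisFun K (Fin n)).constr K fun i =>
    (Pi.basisFun K (Fin p)).constr K fun j => Pi.single (finProdFinEquiv (i, j)) 1

theorem canonicalTensor_index {n p : ℕ} (i : Fin n) (j : Fin p) :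
    (finProdFinEquiv (i, j) : ℕ) = p * i + j := by
  simp [finProdFinEquiv, Nat.add_comm]

theorem canonicalTensor_single (K : Type u) [Field K] {n p : ℕ} (i : Fin n) (j : Fin p) :
    canonicalTensor K n p (Pi.single i 1) (Pi.single j 1) =
      Pi.single (finProdFinEquiv (i, j)) 1 := by
  rw [← Pi.basisFun_apply K (Fin n) i, ← Pi.basisFun_apply K (Fin p) j, canonicalTensor,
    Module.Basis.constr_basis, Module.Basis.constr_basis]

theorem canonicalTensor_unique (K : Type u) [Field K] {n p : ℕ}
    (B : (Fin n → K) →ₗ[K] (Fin p → K) →ₗ[K] (Fin (n * p) → K))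
    (hB : ∀ i j, B (Pi.single i 1) (Pi.single j 1) = Pi.single (finProdFinEquiv (i, j)) 1) :
    B = canonicalTensor K n p := by
  refine (Pi.basisFun K (Fin n)).ext fun i => (Pi.basisFun K (Fin p)).ext fun j => ?_
  rw [Pi.basisFun_apply, Pi.basisFun_apply, hB, canonicalTensor_single]

end BilinearRewriting

/-! Every rewriting step and every AC move preserves denotations in every bilinear structure
(`TensStep.eval_eq`, `TensAC.eval_eq`), so agreement of normal forms implies validity in all
bilinear structures. Validity in tensorial products is a special case, and it conversely gives
validity everywhere because any bilinear map factors linearly through `TensorProduct.mk`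
(`ValidInTensorial.validInBilinear`). The canonical structure is, up to a universe lift, one of the
bilinear structures.

The substance is the return from the canonical structure to normal forms. A term is normal exactly
when it is `0` or a sum of monomials `xᵢ ⊗ yⱼ` or `x . (xᵢ ⊗ yⱼ)` with pairwise distinct pairs `(i,
j)` and with each `x` an `S`-normal scalar other than `0` and `1` (`IsReduced.isNormal`,
`IsNormal.exists_isReduced`). The multiset of monomials of such a sum determines it modulo AC
(`IsSum.tensAC`). In `K ^ (n * p)` the vectors `e i ⊗ e' j` form the canonical basis, so the
denotation of a normal form displays its coefficients (`IsReduced.eval_apply`); as distinct normal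
scalars have distinct values, equal denotations force equal multisets (`Reduced.eq_of_coeffAt_eq`).

Uniqueness of normal forms thus comes from semantics, with no study of critical pairs. Existence
comes from computing a reduced sum by induction on the term (`IsScalarRewriteSystem.normalizes`),
with no termination order for `R'`. -/

namespace BilinearRewriting

open Relation

/-! ### Normal forms and values of closed scalar terms -/

section Scalars

variable {L : FirstOrder.Language.{a, b}} {sym : ScalarSymbols L} {S : Set (L.Term ℕ × L.Term ℕ)}

theorem relabel_subst {α β γ : Type} (g : β → γ) (σ : α → L.Term β) (l : L.Term α) :
    (l.subst σ).relabel g = l.subst fun i => (σ i).relabel g := by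
  induction l with
  | var => rfl
  | func f ts ih => simp only [FirstOrder.Language.Term.subst, FirstOrder.Language.Term.relabel, ih]

/-- Termination is assumed for terms with variables in `ℕ`, while normal forms are needed for closed
terms; relabelling along `Empty.elim` carries closed steps to open ones. -/
theorem ScalarStep.relabel {α β : Type} (g : α → β) {x y : L.Term α} (h : ScalarStep S x y) :
    ScalarStep S (x.relabel g) (y.relabel g) := by
  induction h with
  | rule h σ => rw [relabel_subst, relabel_subst]; exact .rule h _
  | congr f ts i t' _ ih =>
    have e : (fun j => (Function.update ts i t' j).relabel g) =
        Function.update (fun j => (ts j).relabel g) i (t'.relabel g) := by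
      funext j
      rcases eq_or_ne j i with rfl | hj <;> simp [*]
    simp only [FirstOrder.Language.Term.relabel, e]
    exact .congr f _ i _ ih

theorem IsScalarRewriteSystem.exists_normalForm (hS : IsScalarRewriteSystem sym S)
    (x : L.Term Empty) : ∃ c, IsNormalForm (ScalarStep S) x c := by
  have wf : WellFounded fun x y : L.Term Empty => ScalarStep S y x :=
    Subrelation.wf (fun h => ScalarStep.relabel Empty.elim h)
      (InvImage.wf (FirstOrder.Language.Term.relabel Empty.elim) hS.terminating)
  induction x using wf.induction with
  | _ x ih =>
    by_cases hx : IsNormal (ScalarStep S) x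
    · exact ⟨x, .refl, hx⟩
    · simp only [IsNormal, not_forall, not_not] at hx
      obtain ⟨d, hd⟩ := hx
      obtain ⟨c, hc, hn⟩ := ih d hd
      exact ⟨c, .head hd hc, hn⟩

variable {K : Type u} [Field K] [L.Structure K]

/-- A normal form of `y` is also one of `x`, so `x` and `y` have the same value. -/
theorem ScalarStep.evalScalar_eq (hS : IsScalarRewriteSystem sym S) (hK : Defines sym S K)
    {x y : L.Term Empty} (h : ScalarStep S x y) : evalScalar K x = evalScalar K y := by
  obtain ⟨c, hc, hn⟩ := hS.exists_normalForm y
  exact (hK.eval_eq_iff x y).2 ⟨c, ⟨.head h hc, hn⟩, hc, hn⟩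

theorem IsNormal.eq_of_reflTransGen {T : Type*} {r : T → T → Prop} {x y : T} (hx : IsNormal r x)
    (h : ReflTransGen r x y) : x = y := by
  rcases h.cases_head with h | ⟨d, hd, _⟩
  · exact h
  · exact (hx d hd).elim

/-- A normal term reaches only itself, so a common normal form of `x` and `y` is both of them. This
makes evaluation injective on normal scalars. -/
theorem Defines.eq_of_isNormal (hK : Defines sym S K) {x y : L.Term Empty}
    (hx : IsNormal (ScalarStep S) x) (hy : IsNormal (ScalarStep S) y)
    (h : evalScalar K x = evalScalar K y) : x = y := by
  obtain ⟨c, hc, hc'⟩ := (hK.eval_eq_iff x y).1 h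
  rw [hx.eq_of_reflTransGen hc.1, hy.eq_of_reflTransGen hc'.1]

theorem Defines.eval_zero (hK : Defines sym S K) : evalScalar K sym.zero.term = 0 := by
  rw [evalScalar, FirstOrder.Language.Term.realize_constants, hK.zero]

theorem Defines.eval_one (hK : Defines sym S K) : evalScalar K sym.one.term = 1 := by
  rw [evalScalar, FirstOrder.Language.Term.realize_constants, hK.one]

theorem Defines.eval_add (hK : Defines sym S K) (x y : L.Term Empty) :
    evalScalar K (sym.add.apply₂ x y) = evalScalar K x + evalScalar K y := by
  rw [evalScalar, FirstOrder.Language.Term.realize_functions_apply₂, hK.add]; rfl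

theorem Defines.eval_mul (hK : Defines sym S K) (x y : L.Term Empty) :
    evalScalar K (sym.mul.apply₂ x y) = evalScalar K x * evalScalar K y := by
  rw [evalScalar, FirstOrder.Language.Term.realize_functions_apply₂, hK.mul]; rfl

end Scalars

/-! ### Soundness of rewriting, and transfer of equations between structures -/

section Semantics

variable {L : FirstOrder.Language.{a, b}} {sym : ScalarSymbols L} {S : Set (L.Term ℕ × L.Term ℕ)}
  {X Y : Type} {K : Type u} [Field K] [L.Structure K]
  {E F G : Type v} [AddCommGroup E] [Module K E] [AddCommGroup F] [Module K F]
  [AddCommGroup G] [Module K G]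

theorem LinAC.eval_eq (φ : X → E) {s t : LinTerm L X} (h : LinAC s t) :
    s.eval K φ = t.eval K φ := by
  induction h with
  | refl => rfl
  | symm _ ih => exact ih.symm
  | trans _ _ ih₁ ih₂ => exact ih₁.trans ih₂
  | assoc => exact add_assoc _ _ _
  | comm => exact add_comm _ _
  | add _ _ ih₁ ih₂ => simp only [LinTerm.eval, ih₁, ih₂]
  | smul _ _ ih => simp only [LinTerm.eval, ih]

theorem TensAC.eval_eq (B : E →ₗ[K] F →ₗ[K] G) (φ : X → E) (ψ : Y → F) {s t : TensTerm L X Y}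
    (h : TensAC s t) : s.eval B φ ψ = t.eval B φ ψ := by
  induction h with
  | refl => rfl
  | symm _ ih => exact ih.symm
  | trans _ _ ih₁ ih₂ => exact ih₁.trans ih₂
  | assoc => exact add_assoc _ _ _
  | comm => exact add_comm _ _
  | add _ _ ih₁ ih₂ => simp only [TensTerm.eval, ih₁, ih₂]
  | smul _ _ ih => simp only [TensTerm.eval, ih]
  | tensor h₁ h₂ => simp only [TensTerm.eval, h₁.eval_eq, h₂.eval_eq]

/-- The abstract map `f` lets one computation serve both `LinTerm.eval` and `TensTerm.eval`. -/
theorem RuleR.eval_eq (hK : Defines sym S K) {T : Type*} {zero : T} {add : T → T → T}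
    {smul : L.Term Empty → T → T} (f : T → E) (h0 : f zero = 0)
    (ha : ∀ s t, f (add s t) = f s + f t) (hs : ∀ x s, f (smul x s) = evalScalar K x • f s)
    {s t : T} (h : RuleR sym zero add smul s t) : f s = f t := by
  cases h <;> simp only [h0, ha, hs, hK.eval_zero, hK.eval_one, hK.eval_add, hK.eval_mul] <;> module

theorem LinStep.eval_eq (hS : IsScalarRewriteSystem sym S) (hK : Defines sym S K) (φ : X → E)
    {s t : LinTerm L X} (h : LinStep sym S s t) : s.eval K φ = t.eval K φ := by
  induction h with
  | rule h => exact h.eval_eq hK (LinTerm.eval K φ) rfl (fun _ _ => rfl) fun _ _ => rfl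
  | scalar s h => simp only [LinTerm.eval, h.evalScalar_eq hS hK]
  | add_left _ _ ih => simp only [LinTerm.eval, ih]
  | add_right _ _ ih => simp only [LinTerm.eval, ih]
  | smul _ _ ih => simp only [LinTerm.eval, ih]

theorem TensStep.eval_eq (hS : IsScalarRewriteSystem sym S) (hK : Defines sym S K)
    (B : E →ₗ[K] F →ₗ[K] G) (φ : X → E) (ψ : Y → F) {s t : TensTerm L X Y}
    (h : TensStep sym S s t) : s.eval B φ ψ = t.eval B φ ψ := by
  induction h with
  | rule h => exact h.eval_eq hK (TensTerm.eval B φ ψ) rfl (fun _ _ => rfl) fun _ _ => rfl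
  | tensor_rule h => cases h <;> simp [TensTerm.eval, LinTerm.eval]
  | scalar s h => simp only [TensTerm.eval, h.evalScalar_eq hS hK]
  | add_left _ _ ih => simp only [TensTerm.eval, ih]
  | add_right _ _ ih => simp only [TensTerm.eval, ih]
  | smul _ _ ih => simp only [TensTerm.eval, ih]
  | tensor_left _ h => simp only [TensTerm.eval, h.eval_eq hS hK]
  | tensor_right _ h => simp only [TensTerm.eval, h.eval_eq hS hK]

theorem eval_eq_of_reflTransGen (hS : IsScalarRewriteSystem sym S) (hK : Defines sym S K)
    (B : E →ₗ[K] F →ₗ[K] G) (φ : X → E) (ψ : Y → F) {s t : TensTerm L X Y}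
    (h : ReflTransGen (TensStepAC sym S) s t) : s.eval B φ ψ = t.eval B φ ψ := by
  induction h with
  | refl => rfl
  | tail _ h ih =>
    obtain ⟨r, r', h₁, h₂, h₃⟩ := h
    rw [ih, h₁.eval_eq, h₂.eval_eq hS hK, h₃.eval_eq]

theorem NormalFormsAgree.eval_eq (hS : IsScalarRewriteSystem sym S) (hK : Defines sym S K)
    (B : E →ₗ[K] F →ₗ[K] G) (φ : X → E) (ψ : Y → F) {t t' : TensTerm L X Y}
    (h : NormalFormsAgree sym S t t') : t.eval B φ ψ = t'.eval B φ ψ := by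
  obtain ⟨⟨c, hc⟩, ⟨c', hc'⟩, H⟩ := h
  rw [eval_eq_of_reflTransGen hS hK B φ ψ hc.1, eval_eq_of_reflTransGen hS hK B φ ψ hc'.1,
    (H c c' hc hc').eval_eq]

theorem LinTerm.map_eval {E' : Type w} [AddCommGroup E'] [Module K E'] (f : E →ₗ[K] E')
    (φ : X → E) (s : LinTerm L X) : f (s.eval K φ) = s.eval K (f ∘ φ) := by
  induction s <;> simp_all [LinTerm.eval]

/-- Denotations are natural for morphisms of bilinear structures. The lemma is applied to the lift
of `B` to the tensor product and to universe lifts. -/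
theorem TensTerm.map_eval {E' F' G' : Type w} [AddCommGroup E'] [Module K E'] [AddCommGroup F']
    [Module K F'] [AddCommGroup G'] [Module K G'] (B : E →ₗ[K] F →ₗ[K] G)
    (B' : E' →ₗ[K] F' →ₗ[K] G') (f : E →ₗ[K] E') (g : F →ₗ[K] F') (h : G →ₗ[K] G')
    (H : ∀ x y, h (B x y) = B' (f x) (g y)) (φ : X → E) (ψ : Y → F) (t : TensTerm L X Y) :
    h (t.eval B φ ψ) = t.eval B' (f ∘ φ) (g ∘ ψ) := by
  induction t with
  | zero => exact map_zero h
  | add _ _ ih₁ ih₂ => simp only [TensTerm.eval, map_add, ih₁, ih₂]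
  | smul _ _ ih => simp only [TensTerm.eval, map_smul, ih]
  | tensor s t => rw [TensTerm.eval, H, LinTerm.map_eval f, LinTerm.map_eval g, TensTerm.eval]

theorem isTensorialProduct_mk : IsTensorialProduct (TensorProduct.mk K E F) := fun _ _ e e' =>
  ⟨e.tensorProduct e', fun i j => by simp⟩

theorem ValidInTensorial.validInBilinear {t t' : TensTerm L X Y}
    (h : ValidInTensorial.{u, v} K t t') : ValidInBilinear.{u, v} K t t' := by
  intro E F G _ _ _ _ _ _ B φ ψ
  have := congrArg (TensorProduct.lift B) (h E F _ _ isTensorialProduct_mk φ ψ)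
  rwa [TensTerm.map_eval _ B .id .id _ (by simp), TensTerm.map_eval _ B .id .id _ (by simp)] at this

variable (K) in
/-- The equation between the denotations of the two terms in `K ^ (n * p)` for the canonical
assignment. -/
abbrev CanonicalEq {n p : ℕ} (t t' : TensTerm L (Fin n) (Fin p)) : Prop :=
  t.eval (canonicalTensor K n p) (fun i => Pi.single i 1) (fun j => Pi.single j 1) =
    t'.eval (canonicalTensor K n p) (fun i => Pi.single i 1) (fun j => Pi.single j 1)

/-- The spaces `Fin m → K` live in the universe of `K`, whereas validity speaks of a possibly larger
one. The canonical operation is therefore transported to `ULift` copies and the resulting equation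
brought back. -/
theorem ValidInBilinear.canonicalEq {n p : ℕ} {t t' : TensTerm L (Fin n) (Fin p)}
    (h : ValidInBilinear.{u, max u w} K t t') : CanonicalEq K t t' := by
  let e (m : ℕ) : ULift.{w} (Fin m → K) ≃ₗ[K] (Fin m → K) := ULift.moduleEquiv
  let B := ((canonicalTensor K n p).compl₁₂ (e n).toLinearMap (e p).toLinearMap).compr₂
    (e (n * p)).symm.toLinearMap
  have := congrArg (e (n * p)).toLinearMap
    (h _ _ _ B (fun i => ⟨Pi.single i 1⟩) (fun j => ⟨Pi.single j 1⟩))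
  rwa [TensTerm.map_eval B (canonicalTensor K n p) (e n).toLinearMap (e p).toLinearMap _
      (fun _ _ => rfl),
    TensTerm.map_eval B (canonicalTensor K n p) (e n).toLinearMap (e p).toLinearMap _
      (fun _ _ => rfl)] at this

end Semantics

/-! ### Sums of monomials as multisets, modulo AC -/

section Monomials

variable {L : FirstOrder.Language.{a, b}} {sym : ScalarSymbols L} {S : Set (L.Term ℕ × L.Term ℕ)}
  {X Y : Type}

/-- The term `xᵢ ⊗ yⱼ` or `x . (xᵢ ⊗ yⱼ)`, according to whether the coefficient is `none`
or `some x`. -/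
def monomial : Option (L.Term Empty) × X × Y → TensTerm L X Y
  | (none, i, j) => .tensor (.var i) (.var j)
  | (some x, i, j) => .smul x (.tensor (.var i) (.var j))

/-- `t` is a sum, bracketed in some way, of the nonempty multiset `A` of monomials. -/
inductive IsSum : TensTerm L X Y → Multiset (Option (L.Term Empty) × X × Y) → Prop
  | bare (i j) : IsSum (.tensor (.var i) (.var j)) {(none, i, j)}
  | smul (x i j) : IsSum (.smul x (.tensor (.var i) (.var j))) {(some x, i, j)}
  | add {s t A B} : IsSum s A → IsSum t B → IsSum (.add s t) (A + B)

theorem isSum_monomial (m : Option (L.Term Empty) × X × Y) : IsSum (monomial m) {m} := by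
  obtain ⟨_ | x, i, j⟩ := m
  · exact .bare i j
  · exact .smul x i j

theorem IsSum.ne_zero {t : TensTerm L X Y} {A} (h : IsSum t A) : A ≠ 0 := by
  induction h <;> simp_all

theorem IsSum.unique {t : TensTerm L X Y} {A B} (h : IsSum t A) (h' : IsSum t B) : A = B := by
  induction h generalizing B with
  | bare => cases h'; rfl
  | smul => cases h'; rfl
  | add _ _ ih₁ ih₂ =>
    cases h' with
    | add h₁ h₂ => rw [ih₁ h₁, ih₂ h₂]

theorem LinAC.eq_var_iff {s t : LinTerm L X} (h : LinAC s t) (i : X) : s = .var i ↔ t = .var i := by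
  induction h with
  | refl => rfl
  | symm _ ih => exact ih.symm
  | trans _ _ ih₁ ih₂ => exact ih₁.trans ih₂
  | _ => simp

theorem TensAC.eq_tensor_var_iff {s t : TensTerm L X Y} (h : TensAC s t) (i : X) (j : Y) :
    s = .tensor (.var i) (.var j) ↔ t = .tensor (.var i) (.var j) := by
  induction h with
  | refl => rfl
  | symm _ ih => exact ih.symm
  | trans _ _ ih₁ ih₂ => exact ih₁.trans ih₂
  | tensor h₁ h₂ => simp [h₁.eq_var_iff, h₂.eq_var_iff]
  | _ => simp

theorem isSum_smul_iff {x : L.Term Empty} {s : TensTerm L X Y} {A} :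
    IsSum (.smul x s) A ↔ ∃ i j, s = .tensor (.var i) (.var j) ∧ A = {(some x, i, j)} := by
  constructor
  · rintro (_ | _)
    exact ⟨_, _, rfl, rfl⟩
  · rintro ⟨i, j, rfl, rfl⟩
    exact .smul x i j

theorem isSum_tensor_iff {s : LinTerm L X} {t : LinTerm L Y} {A} :
    IsSum (.tensor s t) A ↔ ∃ i j, s = .var i ∧ t = .var j ∧ A = {(none, i, j)} := by
  constructor
  · rintro (_ | _)
    exact ⟨_, _, rfl, rfl, rfl⟩
  · rintro ⟨i, j, rfl, rfl, rfl⟩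
    exact .bare i j

theorem isSum_add_iff {s t : TensTerm L X Y} {A} :
    IsSum (.add s t) A ↔ ∃ B C, IsSum s B ∧ IsSum t C ∧ A = B + C := by
  constructor
  · rintro (_ | _ | ⟨h₁, h₂⟩)
    exact ⟨_, _, h₁, h₂, rfl⟩
  · rintro ⟨B, C, h₁, h₂, rfl⟩
    exact .add h₁ h₂

/-- The multiset of monomials is an AC invariant; `IsSum.tensAC` shows that it is a complete one. -/
theorem TensAC.isSum_iff {s t : TensTerm L X Y} (h : TensAC s t)
    (A : Multiset (Option (L.Term Empty) × X × Y)) : IsSum s A ↔ IsSum t A := by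
  induction h generalizing A with
  | refl => rfl
  | symm _ ih => exact (ih A).symm
  | trans _ _ ih₁ ih₂ => exact (ih₁ A).trans (ih₂ A)
  | assoc r s t =>
    simp only [isSum_add_iff]
    constructor
    · rintro ⟨_, D, ⟨B, C, hB, hC, rfl⟩, hD, rfl⟩
      exact ⟨B, _, hB, ⟨C, D, hC, hD, rfl⟩, add_assoc _ _ _⟩
    · rintro ⟨B, _, hB, ⟨C, D, hC, hD, rfl⟩, rfl⟩
      exact ⟨_, D, ⟨B, C, hB, hC, rfl⟩, hD, (add_assoc _ _ _).symm⟩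
  | comm s t =>
    simp only [isSum_add_iff]
    constructor <;> (rintro ⟨B, C, hB, hC, rfl⟩; exact ⟨C, B, hC, hB, add_comm _ _⟩)
  | add _ _ ih₁ ih₂ => simp only [isSum_add_iff, ih₁, ih₂]
  | smul x h => simp only [isSum_smul_iff, h.eq_tensor_var_iff]
  | tensor h₁ h₂ => simp only [isSum_tensor_iff, h₁.eq_var_iff, h₂.eq_var_iff]

theorem TensAC.left_comm (r s t : TensTerm L X Y) :
    TensAC (.add r (.add s t)) (.add s (.add r t)) :=
  .trans (.symm (.assoc _ _ _)) (.trans (.add (.comm _ _) (.refl _)) (.assoc _ _ _))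

theorem eq_and_eq_zero_of_cons_eq_singleton {T : Type*} {m x : T} {A : Multiset T}
    (h : m ::ₘ A = {x}) : m = x ∧ A = 0 := by
  obtain rfl := Multiset.mem_singleton.1 (h ▸ Multiset.mem_cons_self m A)
  exact ⟨rfl, (Multiset.cons_inj_right m).1 h⟩

/-- Any chosen monomial can be moved to the front modulo AC. The case `A = 0` is separate because
`IsSum` has no empty sum. -/
theorem IsSum.exists_cons {t : TensTerm L X Y} {A m} (h : IsSum t (m ::ₘ A)) :
    (A = 0 ∧ TensAC t (monomial m)) ∨ ∃ s, IsSum s A ∧ TensAC t (.add (monomial m) s) := by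
  generalize hC : m ::ₘ A = C at h
  induction h generalizing A with
  | bare i j =>
    obtain ⟨rfl, rfl⟩ := eq_and_eq_zero_of_cons_eq_singleton hC
    exact .inl ⟨rfl, .refl _⟩
  | smul x i j =>
    obtain ⟨rfl, rfl⟩ := eq_and_eq_zero_of_cons_eq_singleton hC
    exact .inl ⟨rfl, .refl _⟩
  | @add s t B C hs ht ih₁ ih₂ =>
    have hm : m ∈ B + C := hC ▸ Multiset.mem_cons_self m A
    rcases Multiset.mem_add.1 hm with hm | hm
    · obtain ⟨B, rfl⟩ := Multiset.exists_cons_of_mem hm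
      rw [Multiset.cons_add, Multiset.cons_inj_right] at hC
      subst hC
      rcases ih₁ rfl with ⟨rfl, h⟩ | ⟨r, hr, h⟩
      · exact .inr ⟨t, by rwa [zero_add], .add h (.refl _)⟩
      · exact .inr ⟨_, hr.add ht, .trans (.add h (.refl _)) (.assoc _ _ _)⟩
    · obtain ⟨C, rfl⟩ := Multiset.exists_cons_of_mem hm
      rw [Multiset.add_cons, Multiset.cons_inj_right] at hC
      subst hC
      rcases ih₂ rfl with ⟨rfl, h⟩ | ⟨r, hr, h⟩
      · exact .inr ⟨s, by rwa [add_zero], .trans (.add (.refl _) h) (.comm _ _)⟩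
      · exact .inr ⟨_, hs.add hr, .trans (.add (.refl _) h) (.left_comm _ _ _)⟩

theorem IsSum.tensAC {A} {s t : TensTerm L X Y} (hs : IsSum s A) (ht : IsSum t A) :
    TensAC s t := by
  induction A using Multiset.induction generalizing s t with
  | empty => exact (hs.ne_zero rfl).elim
  | cons m A ih =>
    rcases hs.exists_cons with ⟨h₀, h⟩ | ⟨r, hr, h⟩ <;>
      rcases ht.exists_cons with ⟨h₀', h'⟩ | ⟨r', hr', h'⟩
    · exact h.trans h'.symm
    · exact (hr'.ne_zero h₀).elim
    · exact (hr.ne_zero h₀').elim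
    · exact h.trans (.trans (.add (.refl _) (ih hr hr')) h'.symm)

/-! ### Normal forms -/

variable (sym S) in
/-- The coefficients of the monomials in `A` are normal, different from `0` and `1`, and no two of
the monomials are proportional. -/
def Reduced (A : Multiset (Option (L.Term Empty) × X × Y)) : Prop :=
  (∀ x k, (some x, k) ∈ A →
    IsNormal (ScalarStep S) x ∧ x ≠ sym.zero.term ∧ x ≠ sym.one.term) ∧
  (A.map Prod.snd).Nodup

theorem Reduced.mono {A B : Multiset (Option (L.Term Empty) × X × Y)} (h : Reduced sym S A)
    (hB : B ≤ A) : Reduced sym S B :=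
  ⟨fun x k hk => h.1 x k (Multiset.mem_of_le hB hk),
    Multiset.nodup_of_le (Multiset.map_le_map hB) h.2⟩

theorem Reduced.disjoint {A B : Multiset (Option (L.Term Empty) × X × Y)}
    (h : Reduced sym S (A + B)) {o o' k} (hA : (o, k) ∈ A) (hB : (o', k) ∈ B) : False := by
  have := h.2
  rw [Multiset.map_add, Multiset.nodup_add] at this
  exact Multiset.disjoint_left.1 this.2.2 (Multiset.mem_map.2 ⟨_, hA, rfl⟩)
    (Multiset.mem_map.2 ⟨_, hB, rfl⟩)

theorem not_linStep_var (i : X) (t : LinTerm L X) : ¬ LinStep sym S (.var i) t := by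
  intro h
  cases h with
  | rule h => cases h

/-- Each left-hand side either has the wrong shape for a sum of monomials, or exhibits a reducible
coefficient, a coefficient `0` or `1`, or two proportional monomials. -/
theorem IsSum.not_tensStep {s t : TensTerm L X Y} {A} (hs : IsSum s A) (hA : Reduced sym S A) :
    ¬ TensStep sym S s t := by
  intro h
  induction h generalizing A with
  | rule h =>
    cases h <;> simp only [isSum_add_iff, isSum_smul_iff] at hs
    case add_zero => obtain ⟨_, _, _, h, _⟩ := hs; cases h
    case zero_smul => obtain ⟨i, j, rfl, rfl⟩ := hs; exact (hA.1 _ _ (Multiset.mem_singleton_self _)).2.1 rfl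
    case one_smul => obtain ⟨i, j, rfl, rfl⟩ := hs; exact (hA.1 _ _ (Multiset.mem_singleton_self _)).2.2 rfl
    case smul_zero => obtain ⟨i, j, h, -⟩ := hs; cases h
    case smul_smul => obtain ⟨i, j, h, -⟩ := hs; cases h
    case smul_add => obtain ⟨i, j, h, -⟩ := hs; cases h
    case smul_add_smul =>
      obtain ⟨_, _, ⟨i, j, rfl, rfl⟩, ⟨i', j', h, rfl⟩, rfl⟩ := hs
      cases h
      exact hA.disjoint (Multiset.mem_singleton_self _) (Multiset.mem_singleton_self _)
    case smul_add_self =>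
      obtain ⟨_, _, ⟨i, j, rfl, rfl⟩, h, rfl⟩ := hs
      cases h
      exact hA.disjoint (Multiset.mem_singleton_self _) (Multiset.mem_singleton_self _)
    case add_self =>
      obtain ⟨B, C, h, h', rfl⟩ := hs
      -- Both summands are the same term, hence have the same nonempty multiset, and any of its
      -- monomials occurs twice in the sum.
      obtain rfl := h.unique h'
      obtain ⟨⟨o, k⟩, hm⟩ := Multiset.exists_mem_of_ne_zero h.ne_zero
      exact hA.disjoint hm hm
  | tensor_rule h => cases h <;> cases hs
  | scalar s h =>
    obtain ⟨i, j, rfl, rfl⟩ := isSum_smul_iff.1 hs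
    exact (hA.1 _ _ (Multiset.mem_singleton_self _)).1 _ h
  | add_left t _ ih =>
    obtain ⟨B, C, h, h', rfl⟩ := isSum_add_iff.1 hs
    exact ih h (hA.mono (Multiset.le_add_right _ _))
  | add_right t _ ih =>
    obtain ⟨B, C, h, h', rfl⟩ := isSum_add_iff.1 hs
    exact ih h' (hA.mono (Multiset.le_add_left _ _))
  | smul x h ih =>
    obtain ⟨i, j, rfl, rfl⟩ := isSum_smul_iff.1 hs
    exact ih (.bare i j) ⟨by simp, by simp⟩
  | tensor_left t h =>
    obtain ⟨i, j, rfl, rfl, rfl⟩ := isSum_tensor_iff.1 hs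
    exact not_linStep_var _ _ h
  | tensor_right t h =>
    obtain ⟨i, j, rfl, rfl, rfl⟩ := isSum_tensor_iff.1 hs
    exact not_linStep_var _ _ h

theorem TensAC.eq_zero_iff {s t : TensTerm L X Y} (h : TensAC s t) : s = .zero ↔ t = .zero := by
  induction h with
  | refl => rfl
  | symm _ ih => exact ih.symm
  | trans _ _ ih₁ ih₂ => exact ih₁.trans ih₂
  | _ => simp

variable (sym S) in
/-- `t` is `0`, with `A` empty, or a sum of the reduced nonempty multiset `A` of monomials. -/
def IsReduced (t : TensTerm L X Y) (A : Multiset (Option (L.Term Empty) × X × Y)) : Prop :=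
  (t = .zero ∧ A = 0) ∨ (IsSum t A ∧ Reduced sym S A)

theorem IsReduced.reduced {t : TensTerm L X Y} {A} (h : IsReduced sym S t A) :
    Reduced sym S A := by
  rcases h with ⟨-, rfl⟩ | h
  · exact ⟨by simp, by simp⟩
  · exact h.2

theorem IsReduced.tensAC {s t : TensTerm L X Y} {A} (hs : IsReduced sym S s A)
    (ht : IsReduced sym S t A) : TensAC s t := by
  rcases hs with ⟨rfl, rfl⟩ | hs <;> rcases ht with ⟨rfl, h⟩ | ht
  · exact .refl _
  · exact (ht.1.ne_zero rfl).elim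
  · exact (hs.1.ne_zero h).elim
  · exact hs.1.tensAC ht.1

theorem IsReduced.isNormal {t : TensTerm L X Y} {A} (h : IsReduced sym S t A) :
    IsNormal (TensStepAC sym S) t := by
  rintro d ⟨s, s', hs, hst, -⟩
  rcases h with ⟨rfl, rfl⟩ | ⟨h, hA⟩
  · obtain rfl := hs.eq_zero_iff.1 rfl
    cases hst with
    | rule h => cases h
    | tensor_rule h => cases h
  · exact ((hs.isSum_iff A).1 h).not_tensStep hA hst

theorem IsNormal.not_tensStep {s s' t : TensTerm L X Y} (h : IsNormal (TensStepAC sym S) t)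
    (hs : TensAC t s) : ¬ TensStep sym S s s' :=
  fun hst => h _ ⟨s, s', hs, hst, .refl _⟩

theorem TensStepAC.add_left {s s' : TensTerm L X Y} (t : TensTerm L X Y)
    (h : TensStepAC sym S s s') : TensStepAC sym S (.add s t) (.add s' t) := by
  obtain ⟨r, r', h₁, h₂, h₃⟩ := h
  exact ⟨_, _, .add h₁ (.refl t), .add_left t h₂, .add h₃ (.refl t)⟩

theorem TensStepAC.add_right {s s' : TensTerm L X Y} (t : TensTerm L X Y)
    (h : TensStepAC sym S s s') : TensStepAC sym S (.add t s) (.add t s') := by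
  obtain ⟨r, r', h₁, h₂, h₃⟩ := h
  exact ⟨_, _, .add (.refl t) h₁, .add_right t h₂, .add (.refl t) h₃⟩

theorem TensStepAC.smul {s s' : TensTerm L X Y} (x : L.Term Empty)
    (h : TensStepAC sym S s s') : TensStepAC sym S (.smul x s) (.smul x s') := by
  obtain ⟨r, r', h₁, h₂, h₃⟩ := h
  exact ⟨_, _, .smul x h₁, .smul x h₂, .smul x h₃⟩

theorem exists_tensStep_monomial_add (o o' : Option (L.Term Empty)) (k : X × Y) :
    ∃ s, TensAC (.add (monomial (o, k)) (monomial (o', k))) s ∧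
      ∃ x, TensStep sym S s (monomial (some x, k)) := by
  rcases o with _ | x <;> rcases o' with _ | y
  · exact ⟨_, .refl _, _, .rule (.add_self _)⟩
  · exact ⟨_, .comm _ _, _, .rule (.smul_add_self _ _)⟩
  · exact ⟨_, .refl _, _, .rule (.smul_add_self _ _)⟩
  · exact ⟨_, .refl _, _, .rule (.smul_add_smul _ _ _)⟩

theorem IsSum.exists_add {t : TensTerm L X Y} {A m} (h : IsSum t A) (hm : m ∈ A) :
    TensAC t (monomial m) ∨ ∃ s, TensAC t (.add (monomial m) s) := by
  obtain ⟨A, rfl⟩ := Multiset.exists_cons_of_mem hm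
  rcases h.exists_cons with h | ⟨s, -, h⟩
  · exact .inl h.2
  · exact .inr ⟨s, h⟩

/-- AC makes the two proportional monomials adjacent, where a rule merges them. The four cases
record whether anything else remains in each summand. -/
theorem not_isNormal_add {s t : TensTerm L X Y} {A B} (hs : IsSum s A) (ht : IsSum t B)
    {o o' k} (hA : (o, k) ∈ A) (hB : (o', k) ∈ B) :
    ¬ IsNormal (TensStepAC sym S) (.add s t) := by
  intro h
  obtain ⟨r, hr, x, hx⟩ := exists_tensStep_monomial_add (sym := sym) (S := S) o o' k
  rcases hs.exists_add hA with h₁ | ⟨s', h₁⟩ <;> rcases ht.exists_add hB with h₂ | ⟨t', h₂⟩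
  · exact h.not_tensStep ((h₁.add h₂).trans hr) hx
  · exact h.not_tensStep ((h₁.add h₂).trans (.trans (.symm (.assoc _ _ _)) (.add hr (.refl _))))
      (.add_left _ hx)
  · exact h.not_tensStep ((h₁.add h₂).trans (.trans (.comm _ _) (.trans (.symm (.assoc _ _ _))
      (.add (.trans (.comm _ _) hr) (.refl _))))) (.add_left _ hx)
  · refine h.not_tensStep ((h₁.add h₂).trans (.trans (.assoc _ _ _) (.trans
      (.add (.refl _) (.left_comm _ _ _)) (.trans (.symm (.assoc _ _ _))
      (.add hr (.refl _)))))) (.add_left _ hx)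

/-- Subterms of sort `G` of a normal term are normal, so structural induction applies; every shape
other than a reduced sum contains a redex. -/
theorem IsNormal.exists_isReduced {t : TensTerm L X Y} (h : IsNormal (TensStepAC sym S) t) :
    ∃ A, IsReduced sym S t A := by
  induction t with
  | zero => exact ⟨0, .inl ⟨rfl, rfl⟩⟩
  | add s t ihs iht =>
    obtain ⟨A, ⟨rfl, -⟩ | ⟨hs, hA⟩⟩ := ihs fun d hd => h _ (hd.add_left t)
    -- The only rule for zero summands has `0` on the right, so the sum is commuted before it
    -- applies.
    · exact (h.not_tensStep (.comm _ _) (.rule (.add_zero _))).elim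
    obtain ⟨B, ⟨rfl, -⟩ | ⟨ht, hB⟩⟩ := iht fun d hd => h _ (hd.add_right s)
    · exact (h.not_tensStep (.refl _) (.rule (.add_zero _))).elim
    refine ⟨A + B, .inr ⟨hs.add ht, ?_, ?_⟩⟩
    · intro x k hk
      exact (Multiset.mem_add.1 hk).elim (hA.1 x k) (hB.1 x k)
    · rw [Multiset.map_add, Multiset.nodup_add]
      refine ⟨hA.2, hB.2, Multiset.disjoint_left.2 fun {k} hk hk' => ?_⟩
      obtain ⟨⟨o, k⟩, hm, rfl⟩ := Multiset.mem_map.1 hk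
      obtain ⟨⟨o', k'⟩, hm', h'⟩ := Multiset.mem_map.1 hk'
      obtain rfl : k' = k := h'
      exact not_isNormal_add hs ht hm hm' h
  | smul x s ih =>
    obtain ⟨A, ⟨rfl, -⟩ | ⟨hs, hA⟩⟩ := ih fun d hd => h _ (hd.smul x)
    · exact (h.not_tensStep (.refl _) (.rule (.smul_zero _))).elim
    cases hs with
    | add => exact (h.not_tensStep (.refl _) (.rule (.smul_add _ _ _))).elim
    | smul => exact (h.not_tensStep (.refl _) (.rule (.smul_smul _ _ _))).elim
    | bare i j =>
      refine ⟨_, .inr ⟨.smul x i j, ?_, by simp⟩⟩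
      simp only [Multiset.mem_singleton, Prod.mk.injEq, Option.some.injEq]
      rintro y k ⟨rfl, -⟩
      refine ⟨fun z hz => h.not_tensStep (.refl _) (.scalar _ hz), ?_, ?_⟩
      · rintro rfl
        exact h.not_tensStep (.refl _) (.rule (.zero_smul _))
      · rintro rfl
        exact h.not_tensStep (.refl _) (.rule (.one_smul _))
  | tensor s t =>
    have h' {r} : ¬ TensStep sym S (.tensor s t) r := h.not_tensStep (.refl _)
    cases s with
    | zero => exact (h' (.tensor_rule (.zero_tensor _))).elim
    | add => exact (h' (.tensor_rule (.add_tensor _ _ _))).elim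
    | smul => exact (h' (.tensor_rule (.smul_tensor _ _ _))).elim
    | var i =>
      cases t with
      | zero => exact (h' (.tensor_rule (.tensor_zero _))).elim
      | add => exact (h' (.tensor_rule (.tensor_add _ _ _))).elim
      | smul => exact (h' (.tensor_rule (.tensor_smul _ _ _))).elim
      | var j => exact ⟨_, .inr ⟨.bare i j, by simp, by simp⟩⟩

/-! ### Existence of normal forms -/

variable (sym S) in
/-- Finitely many rewriting steps, up to AC-equality. -/
def Reduces : TensTerm L X Y → TensTerm L X Y → Prop :=
  ReflTransGen fun s t => TensStep sym S s t ∨ TensAC s t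

theorem TensStep.reduces {s t : TensTerm L X Y} (h : TensStep sym S s t) : Reduces sym S s t :=
  .single (.inl h)

theorem TensAC.reduces {s t : TensTerm L X Y} (h : TensAC s t) : Reduces sym S s t :=
  .single (.inr h)

theorem Reduces.trans {r s t : TensTerm L X Y} (h : Reduces sym S r s) (h' : Reduces sym S s t) :
    Reduces sym S r t :=
  ReflTransGen.trans h h'

theorem Reduces.add_left {s s' : TensTerm L X Y} (t : TensTerm L X Y) (h : Reduces sym S s s') :
    Reduces sym S (.add s t) (.add s' t) :=
  ReflTransGen.lift (TensTerm.add · t) (fun _ _ => Or.imp (TensStep.add_left t) (TensAC.add · (.refl t))) _ _ h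

theorem Reduces.add_right {s s' : TensTerm L X Y} (t : TensTerm L X Y) (h : Reduces sym S s s') :
    Reduces sym S (.add t s) (.add t s') :=
  ReflTransGen.lift (TensTerm.add t) (fun _ _ => Or.imp (TensStep.add_right t) (TensAC.add (.refl t))) _ _ h

theorem Reduces.smul {s s' : TensTerm L X Y} (x : L.Term Empty) (h : Reduces sym S s s') :
    Reduces sym S (.smul x s) (.smul x s') :=
  ReflTransGen.lift (TensTerm.smul x) (fun _ _ => Or.imp (TensStep.smul x) (TensAC.smul x)) _ _ h

theorem reduces_smul_of_scalar {x y : L.Term Empty} (h : ReflTransGen (ScalarStep S) x y)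
    (s : TensTerm L X Y) : Reduces sym S (.smul x s) (.smul y s) :=
  ReflTransGen.lift (TensTerm.smul · s) (fun _ _ h => Or.inl (TensStep.scalar s h)) _ _ h

/-- `Reduces` admits AC moves alone, which `TensStepAC` does not. Such a move is absorbed into the
next rewriting step; if none follows, the starting term is itself taken as normal form, whence a
result only AC-equal to `c`. -/
theorem Reduces.exists_normalForm {t c : TensTerm L X Y} (h : Reduces sym S t c)
    (hc : IsNormal (TensStepAC sym S) c) : ∃ c', IsNormalForm (TensStepAC sym S) t c' := by
  suffices ∃ c', ReflTransGen (TensStepAC sym S) t c' ∧ TensAC c c' by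
    obtain ⟨c', h₁, h₂⟩ := this
    refine ⟨c', h₁, ?_⟩
    rintro d ⟨s, s', h₃, h₄⟩
    exact hc d ⟨s, s', h₂.trans h₃, h₄⟩
  induction h using ReflTransGen.head_induction_on with
  | refl => exact ⟨c, .refl, .refl c⟩
  | head h _ ih =>
    obtain ⟨c', h₁, h₂⟩ := ih
    rcases h with h | h
    · exact ⟨c', .head ⟨_, _, .refl _, h, .refl _⟩ h₁, h₂⟩
    · rcases h₁.cases_head with rfl | ⟨d, ⟨s, s', h₃, h₄⟩, h₅⟩
      · exact ⟨_, .refl, h₂.trans h.symm⟩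
      · exact ⟨c', .head ⟨s, s', h.trans h₃, h₄⟩ h₅, h₂⟩

variable (sym S) in
/-- `t` reduces to a reduced sum of monomials. -/
def Normalizes (t : TensTerm L X Y) : Prop :=
  ∃ c A, Reduces sym S t c ∧ IsReduced sym S c A

theorem Reduces.normalizes {s t : TensTerm L X Y} (h : Reduces sym S s t)
    (ht : Normalizes sym S t) : Normalizes sym S s := by
  obtain ⟨c, A, h₁, h₂⟩ := ht
  exact ⟨c, A, h.trans h₁, h₂⟩

theorem normalizes_zero : Normalizes sym S (.zero : TensTerm L X Y) :=
  ⟨_, _, .refl, .inl ⟨rfl, rfl⟩⟩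

theorem reduces_zero_add (t : TensTerm L X Y) : Reduces sym S (.add .zero t) t :=
  (TensAC.comm _ _).reduces.trans (TensStep.rule (.add_zero _)).reduces

theorem reduces_add_zero (t : TensTerm L X Y) : Reduces sym S (.add t .zero) t :=
  (TensStep.rule (.add_zero _)).reduces

/-- Every monomial reduces to `0` or to a reduced monomial. -/
theorem IsScalarRewriteSystem.reduces_monomial (hS : IsScalarRewriteSystem sym S)
    (o : Option (L.Term Empty)) (k : X × Y) :
    Reduces sym S (monomial (o, k)) .zero ∨
      ∃ o', Reduces sym S (monomial (o, k)) (monomial (o', k)) ∧ Reduced sym S {(o', k)} := by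
  rcases o with _ | x
  · exact .inr ⟨none, .refl, by simp, by simp⟩
  obtain ⟨y, hy, hn⟩ := hS.exists_normalForm x
  have h := reduces_smul_of_scalar (sym := sym) hy (monomial (none, k))
  by_cases h0 : y = sym.zero.term
  · subst h0
    exact .inl (h.trans (TensStep.rule (.zero_smul _)).reduces)
  by_cases h1 : y = sym.one.term
  · subst h1
    exact .inr ⟨none, h.trans (TensStep.rule (.one_smul _)).reduces, by simp, by simp⟩
  refine .inr ⟨some y, h, ?_, by simp⟩
  simp only [Multiset.mem_singleton, Prod.mk.injEq, Option.some.injEq]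
  rintro z _ ⟨rfl, -⟩
  exact ⟨hn, h0, h1⟩

theorem IsScalarRewriteSystem.normalizes_monomial (hS : IsScalarRewriteSystem sym S)
    (m : Option (L.Term Empty) × X × Y) : Normalizes sym S (monomial m) := by
  rcases hS.reduces_monomial m.1 m.2 with h | ⟨o, h, h'⟩
  · exact h.normalizes normalizes_zero
  · exact ⟨_, _, h, .inr ⟨isSum_monomial _, h'⟩⟩

theorem IsScalarRewriteSystem.normalizes_monomial_add_of_notMem (hS : IsScalarRewriteSystem sym S)
    (o : Option (L.Term Empty)) (k : X × Y) {c : TensTerm L X Y} {A} (hc : IsSum c A)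
    (hA : Reduced sym S A) (hk : k ∉ A.map Prod.snd) :
    Normalizes sym S (.add (monomial (o, k)) c) := by
  rcases hS.reduces_monomial o k with h | ⟨o', h, h'⟩
  · exact (h.add_left c).normalizes
      ((reduces_zero_add c).normalizes ⟨c, A, .refl, .inr ⟨hc, hA⟩⟩)
  · refine ⟨_, _, h.add_left c, .inr ⟨(isSum_monomial _).add hc, ?_, ?_⟩⟩
    · intro x l hl
      exact (Multiset.mem_add.1 hl).elim (h'.1 x l) (hA.1 x l)
    · simp only [Multiset.singleton_add, Multiset.map_cons, Multiset.nodup_cons]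
      exact ⟨hk, hA.2⟩

theorem reduces_monomial_add (o o' : Option (L.Term Empty)) (k : X × Y) :
    ∃ x, Reduces sym S (.add (monomial (o, k)) (monomial (o', k))) (monomial (some x, k)) := by
  obtain ⟨s, hs, x, hx⟩ := exists_tensStep_monomial_add (sym := sym) (S := S) o o' k
  exact ⟨x, hs.reduces.trans hx.reduces⟩

/-- Insertion into a reduced sum: a monomial proportional to the new one is moved to the front and
merged with it. The rest then avoids the pair `k`, since pairs in a reduced sum are distinct. -/
theorem IsScalarRewriteSystem.normalizes_monomial_add (hS : IsScalarRewriteSystem sym S)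
    (o : Option (L.Term Empty)) (k : X × Y) {c : TensTerm L X Y} (hc : Normalizes sym S c) :
    Normalizes sym S (.add (monomial (o, k)) c) := by
  obtain ⟨c', A, h, ⟨rfl, -⟩ | ⟨hc', hA⟩⟩ := hc
  · exact ((h.add_right _).trans (reduces_add_zero _)).normalizes (hS.normalizes_monomial _)
  refine (h.add_right _).normalizes ?_
  by_cases hk : k ∈ A.map Prod.snd
  · obtain ⟨⟨o', k⟩, hm, rfl⟩ := Multiset.mem_map.1 hk
    obtain ⟨A, rfl⟩ := Multiset.exists_cons_of_mem hm
    obtain ⟨x, hx⟩ := reduces_monomial_add (sym := sym) (S := S) o o' k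
    rcases hc'.exists_cons with ⟨rfl, h₁⟩ | ⟨d, hd, h₁⟩
    · exact ((h₁.reduces.add_right _).trans hx).normalizes (hS.normalizes_monomial _)
    · refine ((h₁.reduces.add_right _).trans ((TensAC.symm (.assoc _ _ _)).reduces.trans
        (hx.add_left _))).normalizes (hS.normalizes_monomial_add_of_notMem _ _ hd
          (hA.mono (Multiset.le_cons_self _ _)) ?_)
      have := hA.2
      rw [Multiset.map_cons, Multiset.nodup_cons] at this
      exact this.1
  · exact hS.normalizes_monomial_add_of_notMem o k hc' hA hk

/-- The monomials of the normalized left summand are inserted one by one, associativity unfolding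
its bracketing. -/
theorem IsScalarRewriteSystem.normalizes_add (hS : IsScalarRewriteSystem sym S)
    {s t : TensTerm L X Y} (hs : Normalizes sym S s) (ht : Normalizes sym S t) :
    Normalizes sym S (.add s t) := by
  obtain ⟨c, A, h, ⟨rfl, -⟩ | ⟨hc, -⟩⟩ := hs
  · exact ((h.add_left t).trans (reduces_zero_add t)).normalizes ht
  refine (h.add_left t).normalizes ?_
  clear h
  induction hc generalizing t with
  | bare i j => exact hS.normalizes_monomial_add none (i, j) ht
  | smul x i j => exact hS.normalizes_monomial_add (some x) (i, j) ht
  | add _ _ ih₁ ih₂ => exact (TensAC.assoc _ _ _).reduces.normalizes (ih₁ (ih₂ ht))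

theorem IsScalarRewriteSystem.normalizes_smul (hS : IsScalarRewriteSystem sym S)
    (x : L.Term Empty) {s : TensTerm L X Y} (hs : Normalizes sym S s) :
    Normalizes sym S (.smul x s) := by
  obtain ⟨c, A, h, ⟨rfl, -⟩ | ⟨hc, -⟩⟩ := hs
  · exact ((h.smul x).trans (TensStep.rule (.smul_zero x)).reduces).normalizes normalizes_zero
  refine (h.smul x).normalizes ?_
  clear h
  induction hc with
  | bare i j => exact hS.normalizes_monomial (some x, i, j)
  | smul y i j =>
    exact (TensStep.rule (.smul_smul x y _)).reduces.normalizes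
      (hS.normalizes_monomial (some _, i, j))
  | add _ _ ih₁ ih₂ =>
    exact (TensStep.rule (.smul_add x _ _)).reduces.normalizes (hS.normalizes_add ih₁ ih₂)

theorem IsScalarRewriteSystem.normalizes_tensor (hS : IsScalarRewriteSystem sym S)
    (s : LinTerm L X) (t : LinTerm L Y) : Normalizes sym S (.tensor s t) := by
  induction s with
  | zero => exact (TensStep.tensor_rule (.zero_tensor t)).reduces.normalizes normalizes_zero
  | add r s ih₁ ih₂ =>
    exact (TensStep.tensor_rule (.add_tensor r s t)).reduces.normalizes (hS.normalizes_add ih₁ ih₂)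
  | smul x s ih =>
    exact (TensStep.tensor_rule (.smul_tensor x s t)).reduces.normalizes (hS.normalizes_smul x ih)
  | var i =>
    induction t with
    | zero => exact (TensStep.tensor_rule (.tensor_zero _)).reduces.normalizes normalizes_zero
    | add s t ih₁ ih₂ =>
      exact (TensStep.tensor_rule (.tensor_add _ s t)).reduces.normalizes
        (hS.normalizes_add ih₁ ih₂)
    | smul x t ih =>
      exact (TensStep.tensor_rule (.tensor_smul x _ t)).reduces.normalizes
        (hS.normalizes_smul x ih)
    | var j => exact hS.normalizes_monomial (none, i, j)

theorem IsScalarRewriteSystem.normalizes (hS : IsScalarRewriteSystem sym S)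
    (t : TensTerm L X Y) : Normalizes sym S t := by
  induction t with
  | zero => exact normalizes_zero
  | add _ _ ih₁ ih₂ => exact hS.normalizes_add ih₁ ih₂
  | smul x _ ih => exact hS.normalizes_smul x ih
  | tensor s t => exact hS.normalizes_tensor s t

theorem IsScalarRewriteSystem.exists_tens_normalForm (hS : IsScalarRewriteSystem sym S)
    (t : TensTerm L X Y) : ∃ c, IsNormalForm (TensStepAC sym S) t c := by
  obtain ⟨c, A, h, hc⟩ := hS.normalizes t
  exact h.exists_normalForm hc.isNormal

/-! ### Uniqueness of normal forms -/

variable {K : Type u} [Field K] [L.Structure K]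

variable (K) in
/-- The value of the coefficient of a monomial. -/
def coeffValue (o : Option (L.Term Empty)) : K := o.elim 1 (evalScalar K)

theorem Reduced.coeffValue_ne_zero (hS : IsScalarRewriteSystem sym S) (hK : Defines sym S K)
    {A : Multiset (Option (L.Term Empty) × X × Y)} (hA : Reduced sym S A) {o k}
    (h : (o, k) ∈ A) : coeffValue K o ≠ 0 := by
  rcases o with _ | x
  · exact one_ne_zero
  · obtain ⟨h₁, h₂, -⟩ := hA.1 x k h
    exact fun h0 => h₂ (hK.eq_of_isNormal h₁ hS.zero_normal (h0.trans hK.eval_zero.symm))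

/-- A bare monomial cannot be confused with one of explicit coefficient: a normal scalar of value
`1` is the term `1`, which is excluded. -/
theorem Reduced.eq_of_coeffValue_eq (hS : IsScalarRewriteSystem sym S) (hK : Defines sym S K)
    {A A' : Multiset (Option (L.Term Empty) × X × Y)} (hA : Reduced sym S A)
    (hA' : Reduced sym S A') {o o' k k'} (h : (o, k) ∈ A) (h' : (o', k') ∈ A')
    (e : coeffValue K o = coeffValue K o') : o = o' := by
  rcases o with _ | x <;> rcases o' with _ | y
  · rfl
  · obtain ⟨h₁, -, h₂⟩ := hA'.1 y k' h'
    exact (h₂ (hK.eq_of_isNormal h₁ hS.one_normal (e.symm.trans hK.eval_one.symm))).elim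
  · obtain ⟨h₁, -, h₂⟩ := hA.1 x k h
    exact (h₂ (hK.eq_of_isNormal h₁ hS.one_normal (e.trans hK.eval_one.symm))).elim
  · rw [hK.eq_of_isNormal (hA.1 x k h).1 (hA'.1 y k' h').1 e]

variable (K) in
open Classical in
/-- The coefficient of `k` in the sum of the monomials in `A`. -/
noncomputable def coeffAt (A : Multiset (Option (L.Term Empty) × X × Y)) (k : X × Y) : K :=
  (A.map fun m => if m.2 = k then coeffValue K m.1 else 0).sum

theorem coeffAt_of_notMem {A : Multiset (Option (L.Term Empty) × X × Y)} {k : X × Y}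
    (h : k ∉ A.map Prod.snd) : coeffAt K A k = 0 := by
  refine Multiset.sum_eq_zero fun x hx => ?_
  obtain ⟨m, hm, rfl⟩ := Multiset.mem_map.1 hx
  exact if_neg fun e => h (Multiset.mem_map.2 ⟨m, hm, e⟩)

theorem Reduced.coeffAt_of_mem {A : Multiset (Option (L.Term Empty) × X × Y)}
    (hA : Reduced sym S A) {o k} (h : (o, k) ∈ A) : coeffAt K A k = coeffValue K o := by
  obtain ⟨A, rfl⟩ := Multiset.exists_cons_of_mem h
  have h' := hA.2
  rw [Multiset.map_cons, Multiset.nodup_cons] at h'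
  have := coeffAt_of_notMem (K := K) h'.1
  rw [coeffAt] at this ⊢
  rw [Multiset.map_cons, Multiset.sum_cons, this, if_pos rfl, add_zero]

/-- The pair `k` must occur in `A'`, since otherwise its coefficient would vanish, and reduced
coefficients have nonzero value. -/
theorem Reduced.mem_of_coeffAt_eq (hS : IsScalarRewriteSystem sym S) (hK : Defines sym S K)
    {A A' : Multiset (Option (L.Term Empty) × X × Y)} (hA : Reduced sym S A)
    (hA' : Reduced sym S A') (e : coeffAt K A = coeffAt K A') {m} (hm : m ∈ A) : m ∈ A' := by
  obtain ⟨o, k⟩ := m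
  have h₁ := hA.coeffAt_of_mem (K := K) hm
  by_cases hk : k ∈ A'.map Prod.snd
  · obtain ⟨⟨o', k⟩, hm', rfl⟩ := Multiset.mem_map.1 hk
    have h₂ := hA'.coeffAt_of_mem (K := K) hm'
    rwa [hA.eq_of_coeffValue_eq hS hK hA' hm hm' (by rw [← h₁, ← h₂, e])]
  · rw [e, coeffAt_of_notMem hk] at h₁
    exact (hA.coeffValue_ne_zero hS hK hm h₁.symm).elim

theorem Reduced.eq_of_coeffAt_eq (hS : IsScalarRewriteSystem sym S) (hK : Defines sym S K)
    {A A' : Multiset (Option (L.Term Empty) × X × Y)} (hA : Reduced sym S A)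
    (hA' : Reduced sym S A') (e : coeffAt K A = coeffAt K A') : A = A' :=
  (Multiset.Nodup.ext hA.2.of_map hA'.2.of_map).2 fun _ =>
    ⟨hA.mem_of_coeffAt_eq hS hK hA' e, hA'.mem_of_coeffAt_eq hS hK hA e.symm⟩

/-- Under the canonical assignment a monomial with pair `(i, j)` is a multiple of one canonical
basis vector, so each coordinate reads off one coefficient. -/
theorem IsSum.eval_apply {n p : ℕ} {t : TensTerm L (Fin n) (Fin p)} {A} (h : IsSum t A)
    (k : Fin n × Fin p) :
    t.eval (canonicalTensor K n p) (fun i => Pi.single i 1) (fun j => Pi.single j 1)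
      (finProdFinEquiv k) = coeffAt K A k := by
  induction h with
  | bare i j =>
    simp [TensTerm.eval, LinTerm.eval, canonicalTensor_single, coeffAt, coeffValue, Pi.single_apply,
      eq_comm]
  | smul x i j =>
    simp [TensTerm.eval, LinTerm.eval, canonicalTensor_single, coeffAt, coeffValue, Pi.single_apply,
      eq_comm]
  | add _ _ ih₁ ih₂ =>
    rw [TensTerm.eval, Pi.add_apply, ih₁, ih₂, coeffAt, coeffAt, coeffAt, Multiset.map_add,
      Multiset.sum_add]

theorem IsReduced.eval_apply {n p : ℕ} {t : TensTerm L (Fin n) (Fin p)} {A}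
    (h : IsReduced sym S t A) (k : Fin n × Fin p) :
    t.eval (canonicalTensor K n p) (fun i => Pi.single i 1) (fun j => Pi.single j 1)
      (finProdFinEquiv k) = coeffAt K A k := by
  rcases h with ⟨rfl, rfl⟩ | ⟨h, -⟩
  · simp [TensTerm.eval, coeffAt]
  · exact h.eval_apply k

theorem CanonicalEq.normalFormsAgree (hS : IsScalarRewriteSystem sym S) (hK : Defines sym S K)
    {n p : ℕ} {t t' : TensTerm L (Fin n) (Fin p)} (h : CanonicalEq K t t') :
    NormalFormsAgree sym S t t' := by
  refine ⟨hS.exists_tens_normalForm t, hS.exists_tens_normalForm t', fun c c' hc hc' => ?_⟩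
  obtain ⟨A, hA⟩ := hc.2.exists_isReduced
  obtain ⟨A', hA'⟩ := hc'.2.exists_isReduced
  rw [CanonicalEq, eval_eq_of_reflTransGen hS hK _ _ _ hc.1,
    eval_eq_of_reflTransGen hS hK _ _ _ hc'.1] at h
  obtain rfl := hA.reduced.eq_of_coeffAt_eq hS hK hA'.reduced <| by
    funext k
    rw [← hA.eval_apply, ← hA'.eval_apply, h]
  exact hA.tensAC hA'

end Monomials

end BilinearRewriting

theorem mainTheorem9 {L : FirstOrder.Language.{a, b}}
    (sym : BilinearRewriting.ScalarSymbols L) (S : Set (L.Term ℕ × L.Term ℕ))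
    (hS : BilinearRewriting.IsScalarRewriteSystem sym S)
    (K : Type u) [Field K] [L.Structure K] (hK : BilinearRewriting.Defines sym S K)
    (n p : ℕ) (t t' : BilinearRewriting.TensTerm L (Fin n) (Fin p)) :
    List.TFAE [
      BilinearRewriting.NormalFormsAgree sym S t t',
      BilinearRewriting.ValidInBilinear.{u, max u w} K t t',
      BilinearRewriting.ValidInTensorial.{u, max u w} K t t',
      t.eval (BilinearRewriting.canonicalTensor K n p)
          (fun i => Pi.single i 1) (fun j => Pi.single j 1) =
        t'.eval (BilinearRewriting.canonicalTensor K n p)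
          (fun i => Pi.single i 1) (fun j => Pi.single j 1)] := by
  tfae_have 1 → 2 := fun h E F G _ _ _ _ _ _ B φ ψ => h.eval_eq hS hK B φ ψ
  tfae_have 2 → 3 := fun h E F G _ _ _ _ _ _ B _ φ ψ => h E F G B φ ψ
  tfae_have 3 → 2 := BilinearRewriting.ValidInTensorial.validInBilinear
  tfae_have 2 → 4 := BilinearRewriting.ValidInBilinear.canonicalEq
  tfae_have 4 → 1 := BilinearRewriting.CanonicalEq.normalFormsAgree hS hK
  tfae_finish
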